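/- Let $K$ be a field of characteristic zero and let $\mathcal A$ be a line arrangement in $\mathbf P^2_K$, that is, a finite set of two-dimensional linear subspaces of $V=K^3$. Assume that $\mathcal A$ is essential, that is, the intersection of all $H\in\mathcal A$ is $\{0\}$. Let $S=K[x,y,z]$, for each $H\in\mathcal A$ let $\alpha_H\in S$ be a linear form defining $H$, and for a line arrangement $\mathcal B$ put $$D(\mathcal B)=\{\theta\in \mathrm{Der}_K(S)\mid \theta(\alpha_L)\in S\alpha_L \text{ for all } L\in\mathcal B\}.$$ Call $\mathcal B$ free if the $S$-module $D(\mathcal B)$ has a basis $\theta_E,\theta_2,\theta_3$, where $\theta_E=x\partial_x+y\partial_y+z\partial_z$ and $\theta_2,\theta_3$ are homogeneous (a derivation $\theta$ is homogeneous of degree $d$ if $\theta(x),\theta(y),\theta(z)$ are homogeneous polynomials of degree $d$). A double point of $\mathcal A$ is a one-dimensional subspace of $V$ that is an intersection of members of $\mathcal A$ and is contained in exactly two members of $\mathcal A$. Let $n_2(\mathcal A)$ be the number of double points of $\mathcal A$ and, for $H\in\mathcal A$, let $n_2(H)$ be the number of those contained in $H$. Let $H\in\mathcal A$. If $\mathcal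 A\setminus\{H\}$ is free, then $$n_2(\mathcal A)\ \ge\ n_2(H)\ >\ 0 .$$ Equivalently, a line that is added to a free line arrangement always contains at least one double point of the resulting arrangement, provided that the latter is essential. -/

import Mathlib

open MvPolynomial

noncomputable section

/-- A (finite) line arrangement in the projective plane over `K`, given as a finite set of
two-dimensional linear subspaces of `K ^ 3`. -/
structure LineArrangement (K : Type*) [Field K] where
  lines : Finset (Submodule K (Fin 3 → K))
  finrank_eq_two : ∀ H ∈ lines, Module.finrank K H = 2

/-- The linear form `a 0 * x + a 1 * y + a 2 * z` in `K[x, y, z]`. -/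
def linForm {K : Type*} [Field K] (a : Fin 3 → K) : MvPolynomial (Fin 3) K :=
  ∑ i, C (a i) * X i

/-- The linear form with coefficients `a` is a defining linear form of the subspace `H`. -/
def IsDefiningForm {K : Type*} [Field K] (H : Submodule K (Fin 3 → K)) (a : Fin 3 → K) : Prop :=
  ∀ v : Fin 3 → K, v ∈ H ↔ ∑ i, a i * v i = 0

/-- A derivation of `K[x, y, z]` is homogeneous of degree `d` if its values on `x, y, z` are
homogeneous polynomials of degree `d`. -/
def IsHomogeneousDerivation {K : Type*} [Field K]
    (θ : Derivation K (MvPolynomial (Fin 3) K) (MvPolynomial (Fin 3) K)) (d : ℕ) : Prop :=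
  ∀ i : Fin 3, (θ (X i)).IsHomogeneous d

/-- The Euler derivation `x ∂x + y ∂y + z ∂z`. -/
def eulerDerivation (K : Type*) [Field K] :
    Derivation K (MvPolynomial (Fin 3) K) (MvPolynomial (Fin 3) K) :=
  mkDerivation K (fun i => X i)

namespace LineArrangement

variable {K : Type*} [Field K]

/-- The intersection lattice: all intersections of subsets of the arrangement (the empty
intersection being the whole space). -/
def intersectionLattice (A : LineArrangement K) : Set (Submodule K (Fin 3 → K)) :=
  {X | ∃ B : Finset (Submodule K (Fin 3 → K)), B ⊆ A.lines ∧ X = B.inf id}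

/-- The arrangement is essential: the origin belongs to the intersection lattice. -/
def IsEssential (A : LineArrangement K) : Prop :=
  (⊥ : Submodule K (Fin 3 → K)) ∈ A.intersectionLattice

/-- The points of the arrangement: the members of the intersection lattice of codimension two
in `K ^ 3`, that is, of dimension one. -/
def points (A : LineArrangement K) : Set (Submodule K (Fin 3 → K)) :=
  {p | p ∈ A.intersectionLattice ∧ Module.finrank K p = 1}

open scoped Classical in
/-- The Möbius function: the number of lines of the arrangement through `p`, minus one. -/
def mu (A : LineArrangement K) (p : Submodule K (Fin 3 → K)) : ℤ :=
  ((A.lines.filter (fun H => p ≤ H)).card : ℤ) - 1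

/-- The double points of the arrangement. -/
def doublePoints (A : LineArrangement K) : Set (Submodule K (Fin 3 → K)) :=
  {p | p ∈ A.points ∧ A.mu p = 1}

theorem finite_doublePoints (A : LineArrangement K) : A.doublePoints.Finite := by
  classical
  refine (A.lines.powerset.image (fun B => B.inf id)).finite_toSet.subset ?_
  rintro p ⟨⟨⟨B, hB, rfl⟩, _⟩, _⟩
  exact Finset.mem_coe.2 (Finset.mem_image.2 ⟨B, Finset.mem_powerset.2 hB, rfl⟩)

/-- The number of double points of the arrangement. -/
def n2 (A : LineArrangement K) : ℕ :=
  A.doublePoints.ncard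

/-- The number of double points of the arrangement that lie on the line `H`. -/
def n2On (A : LineArrangement K) (H : Submodule K (Fin 3 → K)) : ℕ :=
  {p | p ∈ A.doublePoints ∧ p ≤ H}.ncard

/-- The module of logarithmic vector fields: the derivations `θ` of `S = K[x, y, z]` with
`θ α ∈ S α` for every defining linear form `α` of every line of the arrangement. -/
def logDer (A : LineArrangement K) :
    Submodule (MvPolynomial (Fin 3) K)
      (Derivation K (MvPolynomial (Fin 3) K) (MvPolynomial (Fin 3) K)) where
  carrier := {θ | ∀ H ∈ A.lines, ∀ a : Fin 3 → K, IsDefiningForm H a →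
    linForm a ∣ θ (linForm a)}
  zero_mem' := fun _ _ _ _ => dvd_zero _
  add_mem' := fun h₁ h₂ H hH a ha => dvd_add (h₁ H hH a ha) (h₂ H hH a ha)
  smul_mem' := fun c _ h H hH a ha => Dvd.dvd.mul_left (h H hH a ha) c

/-- The arrangement is free: its module of logarithmic vector fields has a basis consisting of
the Euler derivation and two homogeneous derivations. -/
def IsFree (A : LineArrangement K) : Prop :=
  ∃ (d₂ d₃ : ℕ) (b : Module.Basis (Fin 3) (MvPolynomial (Fin 3) K) A.logDer),
    (b 0 : Derivation K (MvPolynomial (Fin 3) K) (MvPolynomial (Fin 3) K)) = eulerDerivation K ∧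
    IsHomogeneousDerivation (b 1 : Derivation K (MvPolynomial (Fin 3) K) _) d₂ ∧
    IsHomogeneousDerivation (b 2 : Derivation K (MvPolynomial (Fin 3) K) _) d₃

open scoped Classical in
/-- The arrangement with the line `H` removed. -/
def erase (A : LineArrangement K) (H : Submodule K (Fin 3 → K)) : LineArrangement K where
  lines := A.lines.erase H
  finrank_eq_two := fun L hL => A.finrank_eq_two L (Finset.mem_of_mem_erase hL)

end LineArrangement

end

/-! Write B for the arrangement without H, α for a form defining H, and n for the number of points
in which H meets lines of B. If H carries no double point, at least two lines of B pass through each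
of these points, so |B| ≥ 2n; essentiality gives n ≥ 2. Freeness of B is then contradicted by degree
counts on H.

(1) One half of Saito's criterion: the degrees 1, d₂, d₃ of a basis add up to at most |B|
(`sum_degrees_le_card`). (2) For θ in D(B) of degree d, the restriction of θ(α) to H vanishes to
order m - 1 at a point on m lines of B. If it is nonzero, then d ≥ |B| - n (`card_le_degree_add`).
(3) A basis element of degree less than n other than the Euler derivation θ_E has θ(α) nonzero on H
(`restrictLine_basis_ne_zero`). Otherwise a multiple of θ_E can be subtracted so that α is
annihilated; the difference is tangent to second order at the n points, hence zero on H by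
`eq_zero_of_tangent_to_second_order`, hence α times an element of D(B), which no basis allows.

If both θ₂(α) and θ₃(α) are nonzero on H, (2) gives d₂ + d₃ ≥ 2|B| - 2n ≥ |B|, against (1). If only
one is, (2) and (1) force the other degree below n, against (3). If neither is, all of D(B) is
tangent to H, which `exists_basis_not_tangent` excludes. -/

noncomputable section

/-! ### Linear forms, their primality and their kernels. -/

section LinearForms

variable {K : Type*} [Field K]

theorem eval_linForm (a x : Fin 3 → K) : eval x (linForm a) = a ⬝ᵥ x := by
  simp [linForm, dotProduct]

theorem linForm_isHomogeneous (a : Fin 3 → K) : (linForm a).IsHomogeneous 1 :=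
  IsHomogeneous.sum _ _ _ fun i _ => isHomogeneous_C_mul_X (a i) i

theorem linForm_ne_zero {c v : Fin 3 → K} (h : c ⬝ᵥ v ≠ 0) : linForm c ≠ 0 := by
  intro h0
  apply h
  rw [← eval_linForm, h0, map_zero]

/-- The substitution that projects along `w` onto the kernel of the form `c`. -/
def projSubst (c w : Fin 3 → K) : MvPolynomial (Fin 3) K →ₐ[K] MvPolynomial (Fin 3) K :=
  aeval fun i => X i - C (w i) * linForm c

theorem linForm_dvd_sub_projSubst (c w : Fin 3 → K) (f : MvPolynomial (Fin 3) K) :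
    linForm c ∣ f - projSubst c w f := by
  induction f using MvPolynomial.induction_on with
  | C a => simp [projSubst]
  | add p q hp hq =>
    rw [map_add, add_sub_add_comm]
    exact dvd_add hp hq
  | mul_X p i hp =>
    have h : p * X i - projSubst c w (p * X i)
        = (p - projSubst c w p) * X i + linForm c * (C (w i) * projSubst c w p) := by
      rw [map_mul]
      have : projSubst c w (X i) = X i - C (w i) * linForm c := by simp [projSubst]
      rw [this]
      ring
    rw [h]
    exact dvd_add (hp.mul_right _) (dvd_mul_right _ _)

theorem projSubst_linForm {c w : Fin 3 → K} (h : c ⬝ᵥ w = 1) : projSubst c w (linForm c) = 0 := by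
  have h1 : projSubst c w (linForm c) = linForm c - C (c ⬝ᵥ w) * linForm c := by
    simp only [linForm, projSubst, dotProduct, map_sum, map_mul, aeval_X, algHom_C,
      algebraMap_eq, Finset.sum_mul, mul_sub, Finset.sum_sub_distrib]
    simp only [mul_assoc]
  rw [h1, h]
  simp

/-- The substitution is the identity modulo the form and kills the form, so its kernel is the ideal
the form generates. Primality follows because the target is a domain. -/
theorem linForm_dvd_iff_projSubst {c w : Fin 3 → K} (h : c ⬝ᵥ w = 1)
    (f : MvPolynomial (Fin 3) K) : linForm c ∣ f ↔ projSubst c w f = 0 := by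
  constructor
  · rintro ⟨g, rfl⟩
    rw [map_mul, projSubst_linForm h, zero_mul]
  · intro hf
    simpa [hf] using linForm_dvd_sub_projSubst c w f

theorem exists_dotProduct_eq_one {c : Fin 3 → K} (hc : c ≠ 0) : ∃ w, c ⬝ᵥ w = 1 := by
  obtain ⟨i, hi⟩ := Function.ne_iff.1 hc
  exact ⟨Pi.single i (c i)⁻¹, by simpa using mul_inv_cancel₀ hi⟩

theorem linForm_prime {c : Fin 3 → K} (hc : c ≠ 0) : Prime (linForm c) := by
  obtain ⟨w, hw⟩ := exists_dotProduct_eq_one hc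
  refine ⟨linForm_ne_zero (v := w) (by simp [hw]), fun hu => ?_, fun a b hab => ?_⟩
  · have := hu.map (eval (0 : Fin 3 → K))
    rw [eval_linForm, dotProduct_zero] at this
    exact not_isUnit_zero this
  · simpa [linForm_dvd_iff_projSubst hw] using hab

/-- Over an infinite field, a linear form divides every polynomial that vanishes on its kernel. -/
theorem linForm_dvd_iff [Infinite K] {c : Fin 3 → K} (hc : c ≠ 0) (f : MvPolynomial (Fin 3) K) :
    linForm c ∣ f ↔ ∀ x, c ⬝ᵥ x = 0 → eval x f = 0 := by
  constructor
  · rintro ⟨g, rfl⟩ x hx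
    simp [eval_linForm, hx]
  · intro h
    obtain ⟨w, hw⟩ := exists_dotProduct_eq_one hc
    rw [linForm_dvd_iff_projSubst hw]
    refine MvPolynomial.funext fun x => ?_
    have h1 : eval x (projSubst c w f) = eval (fun i => x i - w i * (c ⬝ᵥ x)) f := by
      rw [projSubst, ← aeval_eq_eval, ← aeval_eq_eval, ← AlgHom.comp_apply, comp_aeval]
      simp [aeval_eq_eval, eval_linForm]
    rw [h1, map_zero]
    apply h
    have h2 : (fun i => x i - w i * (c ⬝ᵥ x)) = x - (c ⬝ᵥ x) • w := by
      ext i; simp [mul_comm]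
    rw [h2, dotProduct_sub, dotProduct_smul, hw]
    simp

/-- A linear form vanishing on the kernel of another one is a multiple of it. -/
theorem exists_eq_smul_of_ker_le {c e : Fin 3 → K} (hc : c ≠ 0)
    (h : ∀ x, c ⬝ᵥ x = 0 → e ⬝ᵥ x = 0) : ∃ r : K, e = r • c := by
  obtain ⟨w, hw⟩ := exists_dotProduct_eq_one hc
  refine ⟨e ⬝ᵥ w, funext fun i => ?_⟩
  have := h (Pi.single i 1 - (c i) • w) (by simp [dotProduct_sub, dotProduct_smul, hw])
  simp only [dotProduct_sub, dotProduct_smul, dotProduct_single_one, smul_eq_mul] at this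
  simp only [Pi.smul_apply, smul_eq_mul]
  linear_combination this

theorem functional_eq_dotProduct (f : (Fin 3 → K) →ₗ[K] K) (x : Fin 3 → K) :
    f x = (fun i => f (Pi.single i 1)) ⬝ᵥ x := by
  rw [LinearMap.pi_apply_eq_sum_univ f x]
  refine Finset.sum_congr rfl fun i _ => ?_
  have h : (fun j => if i = j then (1 : K) else 0) = Pi.single i 1 := by
    ext j
    simp [Pi.single_apply, eq_comm]
  rw [h, smul_eq_mul, mul_comm]

theorem exists_isDefiningForm {L : Submodule K (Fin 3 → K)} (hL : Module.finrank K L = 2) :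
    ∃ c : Fin 3 → K, IsDefiningForm L c := by
  have hlt : L < ⊤ := by
    refine lt_top_iff_ne_top.2 fun h => ?_
    rw [h, finrank_top] at hL
    simp at hL
  obtain ⟨f, hf, hle⟩ := Submodule.exists_le_ker_of_lt_top L hlt
  have hk : L = LinearMap.ker f := by
    apply Submodule.eq_of_le_of_finrank_eq hle
    have h1 := LinearMap.finrank_range_add_finrank_ker f
    have h2 : Module.finrank K (LinearMap.range f) = 1 := by
      rw [LinearMap.range_eq_top.2 (LinearMap.surjective hf)]
      simp
    rw [h2] at h1
    simp at h1
    omega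
  refine ⟨fun i => f (Pi.single i 1), fun x => ?_⟩
  rw [hk, LinearMap.mem_ker]
  rw [functional_eq_dotProduct f x]
  rfl

theorem IsDefiningForm.ne_zero {L : Submodule K (Fin 3 → K)} {c : Fin 3 → K}
    (hL : Module.finrank K L = 2) (hc : IsDefiningForm L c) : c ≠ 0 := by
  rintro rfl
  have : L = ⊤ := by
    ext x
    simp [hc x]
  rw [this, finrank_top] at hL
  simp at hL

theorem IsDefiningForm.smul {L : Submodule K (Fin 3 → K)} {c : Fin 3 → K}
    (hc : IsDefiningForm L c) {r : K} (hr : r ≠ 0) : IsDefiningForm L (r • c) := by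
  intro x
  rw [hc x]
  simp [mul_assoc, ← Finset.mul_sum, hr]

theorem IsDefiningForm.mem_iff {L : Submodule K (Fin 3 → K)} {c : Fin 3 → K}
    (hc : IsDefiningForm L c) (x : Fin 3 → K) : x ∈ L ↔ c ⬝ᵥ x = 0 := hc x

end LinearForms

/-! ### Derivations as polynomial vector fields. -/

section Derivations

variable {K : Type*} [Field K]

/-- The value at the point `x` of the vector field `θ`. -/
def derivationValue (θ : Derivation K (MvPolynomial (Fin 3) K) (MvPolynomial (Fin 3) K))
    (x : Fin 3 → K) : Fin 3 → K := fun i => eval x (θ (X i))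

theorem derivation_linForm (θ : Derivation K (MvPolynomial (Fin 3) K) (MvPolynomial (Fin 3) K))
    (a : Fin 3 → K) : θ (linForm a) = ∑ i, C (a i) * θ (X i) := by
  simp [linForm, Derivation.leibniz, ← algebraMap_eq]

theorem eval_derivation_linForm
    (θ : Derivation K (MvPolynomial (Fin 3) K) (MvPolynomial (Fin 3) K)) (a x : Fin 3 → K) :
    eval x (θ (linForm a)) = a ⬝ᵥ derivationValue θ x := by
  simp [derivation_linForm, derivationValue, dotProduct]

theorem derivation_linForm_isHomogeneous
    {θ : Derivation K (MvPolynomial (Fin 3) K) (MvPolynomial (Fin 3) K)} {d : ℕ}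
    (h : IsHomogeneousDerivation θ d) (a : Fin 3 → K) : (θ (linForm a)).IsHomogeneous d := by
  rw [derivation_linForm]
  exact IsHomogeneous.sum _ _ _ fun i _ => (h i).C_mul (a i)

theorem derivation_linForm_combination
    (θ : Derivation K (MvPolynomial (Fin 3) K) (MvPolynomial (Fin 3) K)) {a b e : Fin 3 → K} {r : K}
    (h : a - b = r • e) : θ (linForm a) = θ (linForm b) + C r * θ (linForm e) := by
  have h' : a = b + r • e := by rw [← h]; abel
  subst h'
  simp only [derivation_linForm, Finset.mul_sum, ← Finset.sum_add_distrib]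
  refine Finset.sum_congr rfl fun i _ => ?_
  simp
  ring

theorem linForm_combination {a b e : Fin 3 → K} {r : K}
    (h : a - b = r • e) : linForm a = linForm b + C r * linForm e := by
  have h' : a = b + r • e := by rw [← h]; abel
  subst h'
  simp only [linForm, Finset.mul_sum, ← Finset.sum_add_distrib]
  refine Finset.sum_congr rfl fun i _ => ?_
  simp
  ring

theorem eulerDerivation_linForm (a : Fin 3 → K) : eulerDerivation K (linForm a) = linForm a := by
  simp [eulerDerivation, mkDerivation_X, linForm]

@[simp] theorem derivationValue_euler (x : Fin 3 → K) :
    derivationValue (eulerDerivation K) x = x := by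
  ext i
  simp [derivationValue, eulerDerivation, mkDerivation_X]

theorem derivationValue_smul (f : MvPolynomial (Fin 3) K)
    (θ : Derivation K (MvPolynomial (Fin 3) K) (MvPolynomial (Fin 3) K)) (x : Fin 3 → K) :
    derivationValue (f • θ) x = eval x f • derivationValue θ x := by
  ext i
  simp [derivationValue]

theorem derivationValue_add
    (θ η : Derivation K (MvPolynomial (Fin 3) K) (MvPolynomial (Fin 3) K)) (x : Fin 3 → K) :
    derivationValue (θ + η) x = derivationValue θ x + derivationValue η x := by
  ext i
  simp [derivationValue]

theorem derivationValue_sum {ι : Type*} (s : Finset ι)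
    (θ : ι → Derivation K (MvPolynomial (Fin 3) K) (MvPolynomial (Fin 3) K)) (x : Fin 3 → K) :
    derivationValue (∑ i ∈ s, θ i) x = ∑ i ∈ s, derivationValue (θ i) x := by
  classical
  induction s using Finset.induction_on with
  | empty => ext i; simp [derivationValue]
  | insert a s ha ih => rw [Finset.sum_insert ha, Finset.sum_insert ha, derivationValue_add, ih]

/-- Turns the divisibility condition into pointwise tangency, which does not depend on the chosen
defining form. -/
theorem linForm_dvd_derivation_iff [Infinite K] {L : Submodule K (Fin 3 → K)}
    (hL : Module.finrank K L = 2) {c : Fin 3 → K} (hc : IsDefiningForm L c)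
    (θ : Derivation K (MvPolynomial (Fin 3) K) (MvPolynomial (Fin 3) K)) :
    linForm c ∣ θ (linForm c) ↔ ∀ x ∈ L, derivationValue θ x ∈ L := by
  rw [linForm_dvd_iff (hc.ne_zero hL)]
  simp only [eval_derivation_linForm, ← hc.mem_iff]

theorem LineArrangement.mem_logDer_iff [Infinite K] (A : LineArrangement K)
    (θ : Derivation K (MvPolynomial (Fin 3) K) (MvPolynomial (Fin 3) K)) :
    θ ∈ A.logDer ↔ ∀ L ∈ A.lines, ∀ x ∈ L, derivationValue θ x ∈ L := by
  constructor
  · intro h L hL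
    obtain ⟨c, hc⟩ := exists_isDefiningForm (A.finrank_eq_two L hL)
    exact (linForm_dvd_derivation_iff (A.finrank_eq_two L hL) hc θ).1 (h L hL c hc)
  · intro h L hL c hc
    exact (linForm_dvd_derivation_iff (A.finrank_eq_two L hL) hc θ).2 (h L hL)

end Derivations

/-! ### Second-order tangency in one variable. -/

section Univariate

/-- A planar vector field `f ∂ + g ∂'` of degree less than `n`, restricted to an affine line, that
is tangent to second order to `n ≥ 2` lines through the origin is zero. -/
theorem eq_zero_of_tangent_to_second_order {K : Type*} [Field K] [CharZero K] (T : Finset K)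
    (hT : 2 ≤ T.card) (f g : Polynomial K) (hf : f.degree < T.card) (hg : g.degree < T.card)
    (h : ∀ t ∈ T, (Polynomial.X - Polynomial.C t) ^ 2 ∣ g - Polynomial.C t * f) : f = 0 ∧ g = 0 := by
  obtain ⟨n, hn⟩ : ∃ n, T.card = n + 2 := ⟨T.card - 2, by omega⟩
  rw [hn] at hf hg
  have hfc : ∀ k, n + 2 ≤ k → f.coeff k = 0 := fun k hk =>
    Polynomial.coeff_eq_zero_of_degree_lt (hf.trans_le (by exact_mod_cast hk))
  have hgc : ∀ k, n + 2 ≤ k → g.coeff k = 0 := fun k hk =>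
    Polynomial.coeff_eq_zero_of_degree_lt (hg.trans_le (by exact_mod_cast hk))
  -- At each t in T both w and w' + f vanish. The degree of w may equal the size of T, one too many
  -- to conclude at once, so w' + f = 0 is shown first.
  set w := g - Polynomial.X * f with hw
  have hwc : ∀ k, n + 2 ≤ k → w.coeff (k + 1) = 0 := fun k hk => by
    rw [hw, Polynomial.coeff_sub, Polynomial.coeff_X_mul, hfc k hk, hgc _ (by omega), sub_zero]
  have hwt : w.coeff (n + 2) = - f.coeff (n + 1) := by
    rw [hw, Polynomial.coeff_sub, Polynomial.coeff_X_mul, hgc _ le_rfl, zero_sub]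
  have hdT : ∀ t ∈ T, Polynomial.eval t w = 0 ∧ Polynomial.eval t (Polynomial.derivative w + f) = 0 := by
    intro t ht
    obtain ⟨q, hq⟩ := h t ht
    have hq' : w = (Polynomial.X - Polynomial.C t) ^ 2 * q - (Polynomial.X - Polynomial.C t) * f := by
      rw [hw]; linear_combination hq
    constructor
    · rw [hq']; simp
    · rw [hq']; simp [Polynomial.derivative_pow]
  have hd : Polynomial.derivative w + f = 0 := by
    apply Polynomial.eq_zero_of_degree_lt_of_eval_finset_eq_zero T _ fun t ht => (hdT t ht).2
    rw [hn, Polynomial.degree_lt_iff_coeff_zero]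
    intro k hk
    rw [Polynomial.coeff_add, Polynomial.coeff_derivative, hwc k hk, hfc k hk]
    simp
  have hc : w.coeff (n + 2) = 0 := by
    have h1 := congrArg (fun p => p.coeff (n + 1)) hd
    simp only [Polynomial.coeff_add, Polynomial.coeff_derivative, Polynomial.coeff_zero] at h1
    -- Differentiation contributes the factor n + 2 and `hwt` removes one. The remaining n + 1 = |T|
    -- - 1 is nonzero in characteristic zero.
    have h2 : w.coeff (n + 2) * ((n : K) + 1) = 0 := by
      rw [show n + 1 + 1 = n + 2 from rfl] at h1
      push_cast at h1
      linear_combination h1 - hwt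
    exact (mul_eq_zero.1 h2).resolve_right (by exact_mod_cast Nat.succ_ne_zero n)
  have hw0 : w = 0 := by
    apply Polynomial.eq_zero_of_degree_lt_of_eval_finset_eq_zero T _ fun t ht => (hdT t ht).1
    rw [hn, Polynomial.degree_lt_iff_coeff_zero]
    intro k hk
    rcases hk.eq_or_lt with rfl | hk
    · exact hc
    · obtain ⟨j, rfl⟩ : ∃ j, k = j + 1 := ⟨k - 1, by omega⟩
      exact hwc j (by omega)
  have hf0 : f = 0 := by simpa [hw0] using hd
  refine ⟨hf0, ?_⟩
  simpa [hf0, hw0] using hw.symm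

end Univariate

/-! ### Restriction to affine lines and homogeneity. -/

section Restriction

variable {K : Type*} [Field K]

/-- Restriction of a polynomial to the affine line `u + t v`. -/
def restrictLine (u v : Fin 3 → K) : MvPolynomial (Fin 3) K →ₐ[K] Polynomial K :=
  aeval fun i => Polynomial.C (u i) + Polynomial.X * Polynomial.C (v i)

theorem natDegree_restrictLine_le (u v : Fin 3 → K) {f : MvPolynomial (Fin 3) K} {d : ℕ}
    (hf : f.totalDegree ≤ d) : (restrictLine u v f).natDegree ≤ d := by
  have := aeval_natDegree_le f hf
    (fun i => Polynomial.C (u i) + Polynomial.X * Polynomial.C (v i)) (n := 1) fun i => by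
      rw [add_comm, mul_comm]
      exact Polynomial.natDegree_linear_le
  rwa [mul_one] at this

theorem eval_restrictLine (u v : Fin 3 → K) (f : MvPolynomial (Fin 3) K) (t : K) :
    (restrictLine u v f).eval t = eval (u + t • v) f := by
  have : (Polynomial.aeval t).comp (restrictLine u v) = aeval (u + t • v) := by
    apply MvPolynomial.algHom_ext
    intro i
    simp [restrictLine]
    ring
  have h := congrArg (fun φ => φ f) this
  simpa [Polynomial.coe_aeval_eq_eval, aeval_eq_eval] using h

theorem restrictLine_linForm (u v c : Fin 3 → K) :
    restrictLine u v (linForm c)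
      = Polynomial.C (c ⬝ᵥ u) + Polynomial.X * Polynomial.C (c ⬝ᵥ v) := by
  simp only [linForm, dotProduct, restrictLine, map_sum, map_mul, algHom_C, aeval_X,
    Finset.mul_sum, ← Finset.sum_add_distrib, Polynomial.algebraMap_eq]
  refine Finset.sum_congr rfl fun i _ => ?_
  ring

theorem eval_smul_of_isHomogeneous {f : MvPolynomial (Fin 3) K} {d : ℕ} (hf : f.IsHomogeneous d)
    (s : K) (x : Fin 3 → K) : eval (s • x) f = s ^ d * eval x f := by
  rw [eval_eq, eval_eq, Finset.mul_sum]
  refine Finset.sum_congr rfl fun m hm => ?_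
  have hd := hf.degree_eq_sum_deg_support hm
  simp only [Pi.smul_apply, smul_eq_mul, mul_pow, Finset.prod_mul_distrib]
  rw [Finset.prod_pow_eq_pow_sum, hd]
  ring

/-- A homogeneous polynomial that vanishes on an affine line vanishes on the plane through the
origin spanned by that line. -/
theorem eval_eq_zero_of_restrictLine_eq_zero [Infinite K] {u v : Fin 3 → K}
    {f : MvPolynomial (Fin 3) K} {d : ℕ} (hf : f.IsHomogeneous d) (h : restrictLine u v f = 0)
    (s r : K) : eval (s • u + r • v) f = 0 := by
  have hne : ∀ s : K, s ≠ 0 → eval (s • u + r • v) f = 0 := by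
    intro s hs
    have h1 : s • u + r • v = s • (u + (s⁻¹ * r) • v) := by
      rw [smul_add, smul_smul, mul_inv_cancel_left₀ hs]
    rw [h1, eval_smul_of_isHomogeneous hf, ← eval_restrictLine, h]
    simp
  -- Points with s = 0 are not multiples of points of the affine line; for fixed r they are reached
  -- as zeros of a polynomial in s that vanishes for all s ≠ 0.
  have h0 : restrictLine (r • v) u f = 0 := by
    refine Polynomial.eq_zero_of_infinite_isRoot _
      ((Set.finite_singleton (0 : K)).infinite_compl.mono ?_)
    intro s hs
    rw [Set.mem_ofPred_eq, Polynomial.IsRoot, eval_restrictLine, add_comm]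
    exact hne s hs
  rw [add_comm, ← eval_restrictLine, h0]
  simp

/-- A quotient of homogeneous polynomials can be taken homogeneous. -/
theorem exists_homogeneous_quotient {α φ : MvPolynomial (Fin 3) K} (hα : α.IsHomogeneous 1) {d : ℕ}
    (hφ : φ.IsHomogeneous (d + 1)) (h : α ∣ φ) :
    ∃ q : MvPolynomial (Fin 3) K, q.IsHomogeneous d ∧ φ = α * q := by
  obtain ⟨q, rfl⟩ := h
  let _ : GradedAlgebra (homogeneousSubmodule (Fin 3) K) := gradedAlgebra
  refine ⟨DirectSum.decompose (homogeneousSubmodule (Fin 3) K) q d,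
    (DirectSum.decompose (homogeneousSubmodule (Fin 3) K) q d).2, ?_⟩
  have h1 := DirectSum.coe_decompose_mul_of_left_mem_of_le (homogeneousSubmodule (Fin 3) K)
    (a := α) (b := q) (i := 1) (n := d + 1) hα (by omega)
  rw [DirectSum.decompose_of_mem_same _ hφ] at h1
  exact h1

end Restriction

/-! ### Adapted bases of a plane; coprimality of the defining forms. -/

section Frames

variable {K : Type*} [Field K]

theorem exists_dotProduct_separating {v x : Fin 3 → K} (h : x ∉ Submodule.span K {v}) :
    ∃ p : Fin 3 → K, p ⬝ᵥ x = 1 ∧ p ⬝ᵥ v = 0 := by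
  obtain ⟨f, hfx, hf⟩ := Submodule.exists_le_ker_of_notMem h
  refine ⟨(f x)⁻¹ • fun i => f (Pi.single i 1), ?_, ?_⟩
  · rw [smul_dotProduct, ← functional_eq_dotProduct, smul_eq_mul, inv_mul_cancel₀ hfx]
  · have : f v = 0 := hf (Submodule.mem_span_singleton_self v)
    rw [smul_dotProduct, ← functional_eq_dotProduct, this, smul_zero]

/-- A nonzero vector of a plane is part of a basis of the plane with a dual pair of covectors. -/
theorem exists_adapted_frame {H : Submodule K (Fin 3 → K)} (hH : Module.finrank K H = 2)
    {v : Fin 3 → K} (hv : v ∈ H) (hv0 : v ≠ 0) :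
    ∃ u ∈ H, ∃ p q : Fin 3 → K, p ⬝ᵥ u = 1 ∧ p ⬝ᵥ v = 0 ∧ q ⬝ᵥ u = 0 ∧ q ⬝ᵥ v = 1 ∧
      ∀ x ∈ H, x = (p ⬝ᵥ x) • u + (q ⬝ᵥ x) • v := by
  obtain ⟨u, hu, huv⟩ : ∃ u ∈ H, u ∉ Submodule.span K {v} := by
    by_contra! hcon
    have h1 := Submodule.finrank_mono (show H ≤ Submodule.span K {v} from hcon)
    rw [finrank_span_singleton hv0, hH] at h1
    omega
  have hvu : v ∉ Submodule.span K {u} := by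
    intro h
    obtain ⟨r, rfl⟩ := Submodule.mem_span_singleton.1 h
    have hr : r ≠ 0 := by rintro rfl; simp at hv0
    exact huv (Submodule.mem_span_singleton.2 ⟨r⁻¹, by rw [smul_smul, inv_mul_cancel₀ hr, one_smul]⟩)
  obtain ⟨p, hpu, hpv⟩ := exists_dotProduct_separating huv
  obtain ⟨q, hqv, hqu⟩ := exists_dotProduct_separating hvu
  refine ⟨u, hu, p, q, hpu, hpv, hqu, hqv, fun x hx => ?_⟩
  have hli : LinearIndependent K ![u, v] := by
    rw [LinearIndependent.pair_iff]
    intro s r hsr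
    have h1 := congrArg (fun y => p ⬝ᵥ y) hsr
    have h2 := congrArg (fun y => q ⬝ᵥ y) hsr
    simp [dotProduct_add, dotProduct_smul, hpu, hpv, hqu, hqv] at h1 h2
    exact ⟨h1, h2⟩
  have hspan : Submodule.span K {u, v} = H := by
    apply Submodule.eq_of_le_of_finrank_eq
    · rw [Submodule.span_le]
      rintro y (rfl | rfl)
      exacts [hu, hv]
    · have := finrank_span_eq_card hli
      rw [Matrix.range_cons_cons_empty] at this
      rw [this, hH]
      rfl
  rw [← hspan] at hx
  obtain ⟨s, r, rfl⟩ := Submodule.mem_span_pair.1 hx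
  simp [dotProduct_add, dotProduct_smul, hpu, hpv, hqu, hqv]

theorem exists_ne_zero_mem {H : Submodule K (Fin 3 → K)} (hH : Module.finrank K H = 2) :
    ∃ v ∈ H, v ≠ 0 := by
  have : H ≠ ⊥ := by
    rintro rfl
    simp at hH
  exact (Submodule.ne_bot_iff H).1 this

theorem IsDefiningForm.linForm_dvd_linForm_iff [Infinite K] {L L' : Submodule K (Fin 3 → K)}
    {c c' : Fin 3 → K} (hL : Module.finrank K L = 2) (hL' : Module.finrank K L' = 2)
    (hc : IsDefiningForm L c) (hc' : IsDefiningForm L' c') :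
    linForm c ∣ linForm c' ↔ L = L' := by
  rw [linForm_dvd_iff (hc.ne_zero hL)]
  simp only [eval_linForm, ← hc.mem_iff, ← hc'.mem_iff]
  constructor
  · intro h
    exact Submodule.eq_of_le_of_finrank_eq h (hL.trans hL'.symm)
  · rintro rfl x hx
    exact hx

theorem LineArrangement.isRelPrime_linForm [Infinite K] (B : LineArrangement K)
    {c : Submodule K (Fin 3 → K) → Fin 3 → K} (hc : ∀ L ∈ B.lines, IsDefiningForm L (c L)) :
    (B.lines : Set (Submodule K (Fin 3 → K))).Pairwise
      (Function.onFun IsRelPrime fun L => linForm (c L)) := by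
  intro L hL L' hL' hne
  have h1 := B.finrank_eq_two L hL
  have h2 := B.finrank_eq_two L' hL'
  refine ((linForm_prime ((hc L hL).ne_zero h1)).irreducible.isRelPrime_iff_not_dvd).2 ?_
  rwa [(hc L hL).linForm_dvd_linForm_iff h1 h2 (hc L' hL')]

end Frames

/-! ### Divisibility in factorial rings. -/

section Divisibility

variable {R : Type*} [CommRing R] [UniqueFactorizationMonoid R]

theorem dvd_of_dvd_mul_of_isRelPrime {d x u v : R} (hu : d ∣ x * u) (hv : d ∣ x * v)
    (huv : IsRelPrime u v) : d ∣ x := by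
  classical
  let _ : GCDMonoid R := UniqueFactorizationMonoid.toGCDMonoid R
  have h1 : d ∣ gcd (x * u) (x * v) := dvd_gcd hu hv
  have h2 : IsUnit (gcd u v) := gcd_isUnit_iff_isRelPrime.2 huv
  have h3 : d ∣ x * gcd u v := h1.trans (gcd_mul_left' x u v).dvd
  exact h2.dvd_mul_right.1 h3

/-- No prime divides all the cofactors, since the p i are pairwise coprime; so their squares have
gcd 1. -/
theorem dvd_of_forall_dvd_mul_prod_erase_sq {ι : Type*} [DecidableEq ι] {s : Finset ι}
    (hs : s.Nonempty) {p : ι → R}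
    (hp : (s : Set ι).Pairwise (Function.onFun IsRelPrime p)) {d Q : R}
    (h : ∀ i ∈ s, d ∣ Q * (∏ j ∈ s.erase i, p j) ^ 2) : d ∣ Q := by
  -- Singletons T give the hypothesis and T = s the goal; enlarging T by k removes the factor p k.
  suffices H : ∀ T : Finset ι, T.Nonempty → T ⊆ s → d ∣ Q * (∏ j ∈ s \ T, p j) ^ 2 by
    simpa using H s hs subset_rfl
  intro T hT
  induction hT using Finset.Nonempty.cons_induction with
  | singleton a =>
    intro ha
    rw [← Finset.erase_eq]
    exact h a (ha (Finset.mem_singleton_self a))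
  | cons k T hk hT ih =>
    intro hsub
    have hks : k ∈ s := hsub (Finset.mem_cons_self k T)
    have hTs : T ⊆ s := fun i hi => hsub (Finset.mem_cons_of_mem hi)
    have e1 : ∏ j ∈ s \ T, p j = (∏ j ∈ s \ Finset.cons k T hk, p j) * p k := by
      rw [Finset.cons_eq_insert, Finset.sdiff_insert,
        Finset.prod_erase_mul _ _ (Finset.mem_sdiff.2 ⟨hks, hk⟩)]
    have e2 : ∏ j ∈ s.erase k, p j
        = (∏ j ∈ s \ Finset.cons k T hk, p j) * ∏ j ∈ T, p j := by
      rw [← Finset.prod_sdiff (s₁ := T) (s₂ := s.erase k)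
        (fun i hi => Finset.mem_erase.2 ⟨fun h => hk (h ▸ hi), hTs hi⟩)]
      congr 1
      apply Finset.prod_congr _ fun _ _ => rfl
      ext i
      simp only [Finset.mem_sdiff, Finset.mem_erase, Finset.mem_cons]
      tauto
    have h1 := ih hTs
    have h2 := h k hks
    rw [e1, mul_pow, ← mul_assoc] at h1
    rw [e2, mul_pow, ← mul_assoc] at h2
    refine dvd_of_dvd_mul_of_isRelPrime h1 h2 (IsRelPrime.pow (IsRelPrime.prod_right fun i hi => ?_))
    exact hp hks (hTs hi) fun h => hk (h ▸ hi)

end Divisibility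

/-! ### The degree bound from Saito's determinant. -/

section Saito

variable {K : Type*} [Field K]

/-- The derivation `f ∂_w`. -/
def directionalDerivation (f : MvPolynomial (Fin 3) K) (w : Fin 3 → K) :
    Derivation K (MvPolynomial (Fin 3) K) (MvPolynomial (Fin 3) K) :=
  mkDerivation K fun i => f * C (w i)

theorem directionalDerivation_X (f : MvPolynomial (Fin 3) K) (w : Fin 3 → K) (i : Fin 3) :
    directionalDerivation f w (X i) = f * C (w i) := by
  rw [directionalDerivation, mkDerivation_X]

theorem derivationValue_directional (f : MvPolynomial (Fin 3) K) (w x : Fin 3 → K) :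
    derivationValue (directionalDerivation f w) x = eval x f • w := by
  ext i
  simp [derivationValue, directionalDerivation_X]

theorem eval_prod_linForm_eq_zero {B : LineArrangement K}
    {c : Submodule K (Fin 3 → K) → Fin 3 → K} (hc : ∀ L ∈ B.lines, IsDefiningForm L (c L))
    {s : Finset (Submodule K (Fin 3 → K))} (hs : s ⊆ B.lines) {L : Submodule K (Fin 3 → K)}
    (hL : L ∈ s) {x : Fin 3 → K} (hx : x ∈ L) :
    eval x (∏ L ∈ s, linForm (c L)) = 0 := by
  rw [map_prod]
  exact Finset.prod_eq_zero hL (by rw [eval_linForm, ← (hc L (hs hL)).mem_iff]; exact hx)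

theorem directionalDerivation_prod_mem [Infinite K] {B : LineArrangement K}
    {c : Submodule K (Fin 3 → K) → Fin 3 → K} (hc : ∀ L ∈ B.lines, IsDefiningForm L (c L))
    (w : Fin 3 → K) : directionalDerivation (∏ L ∈ B.lines, linForm (c L)) w ∈ B.logDer := by
  rw [B.mem_logDer_iff]
  intro L hL x hx
  rw [derivationValue_directional, eval_prod_linForm_eq_zero hc subset_rfl hL hx, zero_smul]
  exact L.zero_mem

open scoped Classical in
theorem directionalDerivation_prod_erase_mem [Infinite K] {B : LineArrangement K}
    {c : Submodule K (Fin 3 → K) → Fin 3 → K} (hc : ∀ L ∈ B.lines, IsDefiningForm L (c L))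
    {L₀ : Submodule K (Fin 3 → K)} {w : Fin 3 → K} (hw : w ∈ L₀) :
    directionalDerivation (∏ L ∈ B.lines.erase L₀, linForm (c L)) w ∈ B.logDer := by
  rw [B.mem_logDer_iff]
  intro L hL x hx
  rw [derivationValue_directional]
  by_cases h : L = L₀
  · subst h
    exact L.smul_mem _ hw
  · rw [eval_prod_linForm_eq_zero hc (Finset.erase_subset _ _) (Finset.mem_erase.2 ⟨h, hL⟩) hx,
      zero_smul]
    exact L.zero_mem

/-- The matrix of coefficients of three derivations. -/
def coeffMatrix (θ : Fin 3 → Derivation K (MvPolynomial (Fin 3) K) (MvPolynomial (Fin 3) K)) :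
    Matrix (Fin 3) (Fin 3) (MvPolynomial (Fin 3) K) :=
  Matrix.of fun i j => θ i (X j)

theorem det_coeffMatrix_basis_dvd {B : LineArrangement K}
    (b : Module.Basis (Fin 3) (MvPolynomial (Fin 3) K) B.logDer) (θ : Fin 3 → B.logDer) :
    (coeffMatrix fun i => (b i : Derivation K (MvPolynomial (Fin 3) K) _)).det ∣
      (coeffMatrix fun i => (θ i : Derivation K (MvPolynomial (Fin 3) K) _)).det := by
  refine Dvd.intro_left (Matrix.of fun i k => b.repr (θ i) k).det ?_
  rw [← Matrix.det_mul]
  congr 1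
  ext1 i j
  have h := congrArg
    (fun η : B.logDer => (η : Derivation K (MvPolynomial (Fin 3) K) (MvPolynomial (Fin 3) K)) (X j))
    (b.sum_repr (θ i))
  simp only [Fin.sum_univ_three, Submodule.coe_add, Submodule.coe_smul, Derivation.coe_add,
    Derivation.coe_smul, Pi.add_apply, Pi.smul_apply, smul_eq_mul] at h
  simp only [Matrix.mul_apply, Fin.sum_univ_three, coeffMatrix, Matrix.of_apply]
  exact h

theorem det_coeffMatrix_directional (f : Fin 3 → MvPolynomial (Fin 3) K)
    (W : Matrix (Fin 3) (Fin 3) K) :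
    (coeffMatrix fun i => directionalDerivation (f i) (W i)).det = (∏ i, f i) * C W.det := by
  have h : (coeffMatrix fun i => directionalDerivation (f i) (W i))
      = Matrix.of fun i j => f i * (C.mapMatrix W : Matrix (Fin 3) (Fin 3) (MvPolynomial (Fin 3) K)) i j := by
    ext1 i j
    simp [coeffMatrix, directionalDerivation_X]
  rw [h, Matrix.det_mul_column, RingHom.map_det]

theorem det_coeffMatrix_isHomogeneous
    {θ : Fin 3 → Derivation K (MvPolynomial (Fin 3) K) (MvPolynomial (Fin 3) K)} {d : Fin 3 → ℕ}
    (h : ∀ i, IsHomogeneousDerivation (θ i) (d i)) :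
    (coeffMatrix θ).det.IsHomogeneous (∑ i, d i) := by
  rw [Matrix.det_apply]
  refine IsHomogeneous.sum _ _ _ fun σ _ => ?_
  have hp : (∏ i, coeffMatrix θ (σ i) i).IsHomogeneous (∑ i, d i) := by
    rw [← Equiv.sum_comp σ d]
    exact IsHomogeneous.prod _ _ _ fun i _ => h (σ i) i
  rcases Int.units_eq_one_or (Equiv.Perm.sign σ) with hσ | hσ
  · rw [hσ, one_smul]; exact hp
  · rw [hσ, Units.neg_smul, one_smul]; exact hp.neg

open scoped Classical in
/-- The determinant of a basis of the logarithmic vector fields divides the defining polynomial of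
the arrangement. -/
theorem det_coeffMatrix_basis_dvd_prod [Infinite K] {B : LineArrangement K}
    {c : Submodule K (Fin 3 → K) → Fin 3 → K} (hc : ∀ L ∈ B.lines, IsDefiningForm L (c L))
    (hB : B.lines.Nonempty) (b : Module.Basis (Fin 3) (MvPolynomial (Fin 3) K) B.logDer) :
    (coeffMatrix fun i => (b i : Derivation K (MvPolynomial (Fin 3) K) _)).det ∣
      ∏ L ∈ B.lines, linForm (c L) := by
  refine dvd_of_forall_dvd_mul_prod_erase_sq hB (B.isRelPrime_linForm hc) fun L hL => ?_
  have hL2 := B.finrank_eq_two L hL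
  obtain ⟨v, hv, hv0⟩ := exists_ne_zero_mem hL2
  obtain ⟨u, hu, p, q, hpu, hpv, hqu, hqv, -⟩ := exists_adapted_frame hL2 hv hv0
  obtain ⟨w, hw⟩ := exists_dotProduct_eq_one ((hc L hL).ne_zero hL2)
  have hcu := ((hc L hL).mem_iff u).1 hu
  have hcv := ((hc L hL).mem_iff v).1 hv
  -- With Q the product of all forms and P the product without that of L, the fields Q∂_w, P∂_u,
  -- P∂_v are logarithmic, as u and v lie in L. Their determinant is QP² up to the constant det W,
  -- which is nonzero because pairing with the covectors c L, p, q gives a unitriangular matrix.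
  set W : Matrix (Fin 3) (Fin 3) K := Matrix.of ![w, u, v] with hW
  have hdet : W.det ≠ 0 := by
    intro h0
    have h1 : (W * (Matrix.of ![c L, p, q]).transpose).det = 1 := by
      have e : W * (Matrix.of ![c L, p, q]).transpose
          = Matrix.of ![![1, w ⬝ᵥ p, w ⬝ᵥ q], ![0, 1, 0], ![0, 0, 1]] := by
        rw [dotProduct_comm] at hw hcu hcv hpu hpv hqu hqv
        ext i j
        fin_cases i <;> fin_cases j <;>
          simp [Matrix.mul_apply', hW, Matrix.transpose, Matrix.of_apply] <;> first | assumption | rfl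
      rw [e, Matrix.det_fin_three]
      simp
    rw [Matrix.det_mul, h0, zero_mul] at h1
    exact zero_ne_one h1
  set Q := ∏ L ∈ B.lines, linForm (c L)
  set P := ∏ L ∈ B.lines.erase L, linForm (c L)
  have hmem : ∀ i, directionalDerivation (![Q, P, P] i) (W i) ∈ B.logDer := by
    intro i
    fin_cases i
    · exact directionalDerivation_prod_mem hc w
    · exact directionalDerivation_prod_erase_mem hc hu
    · exact directionalDerivation_prod_erase_mem hc hv
  have h := det_coeffMatrix_basis_dvd b fun i => ⟨_, hmem i⟩
  rw [det_coeffMatrix_directional] at h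
  have hunit : IsUnit (C W.det : MvPolynomial (Fin 3) K) := (isUnit_iff_ne_zero.2 hdet).map C
  rw [hunit.dvd_mul_right] at h
  simpa [Fin.prod_univ_three, mul_assoc, pow_two] using h

theorem prod_linForm_ne_zero {B : LineArrangement K}
    {c : Submodule K (Fin 3 → K) → Fin 3 → K} (hc : ∀ L ∈ B.lines, IsDefiningForm L (c L)) :
    ∏ L ∈ B.lines, linForm (c L) ≠ 0 :=
  Finset.prod_ne_zero_iff.2 fun L hL =>
    (linForm_prime ((hc L hL).ne_zero (B.finrank_eq_two L hL))).ne_zero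

theorem sum_degrees_le_card [Infinite K] {B : LineArrangement K} (hB : B.lines.Nonempty)
    (b : Module.Basis (Fin 3) (MvPolynomial (Fin 3) K) B.logDer) {d : Fin 3 → ℕ}
    (hd : ∀ i, IsHomogeneousDerivation (b i : Derivation K (MvPolynomial (Fin 3) K) _) (d i)) :
    ∑ i, d i ≤ B.lines.card := by
  have hex : ∀ L, ∃ c : Fin 3 → K, L ∈ B.lines → IsDefiningForm L c := fun L => by
    by_cases hL : L ∈ B.lines
    · obtain ⟨c, hc⟩ := exists_isDefiningForm (B.finrank_eq_two L hL)
      exact ⟨c, fun _ => hc⟩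
    · exact ⟨0, fun h => absurd h hL⟩
  choose c hc using hex
  have hQ := prod_linForm_ne_zero hc
  obtain ⟨r, hr⟩ := det_coeffMatrix_basis_dvd_prod hc hB b
  have hhom : (∏ L ∈ B.lines, linForm (c L)).IsHomogeneous (∑ L ∈ B.lines, 1) :=
    IsHomogeneous.prod _ _ _ fun L _ => linForm_isHomogeneous _
  have hdeg := hhom.totalDegree hQ
  rw [hr] at hQ hdeg
  rw [totalDegree_mul_of_isDomain (left_ne_zero_of_mul hQ) (right_ne_zero_of_mul hQ),
    (det_coeffMatrix_isHomogeneous hd).totalDegree (left_ne_zero_of_mul hQ)] at hdeg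
  simp only [Finset.sum_const, smul_eq_mul, mul_one] at hdeg
  omega

end Saito

/-- Coordinates for the lines of `B` along a further line `H`: a basis `u, v` of `H` with a dual
pair of covectors `p, q`, such that `v` lies on no line of `B`, and defining forms of the lines of
`B` normalized to take the value `1` at `v`. -/
structure TransversalFrame {K : Type*} [Field K] (B : LineArrangement K)
    (H : Submodule K (Fin 3 → K)) where
  form : Fin 3 → K
  isDefiningForm_form : IsDefiningForm H form
  finrank_eq_two : Module.finrank K H = 2
  notMem : H ∉ B.lines
  u : Fin 3 → K
  v : Fin 3 → K
  u_mem : u ∈ H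
  v_mem : v ∈ H
  p : Fin 3 → K
  q : Fin 3 → K
  p_u : p ⬝ᵥ u = 1
  p_v : p ⬝ᵥ v = 0
  q_u : q ⬝ᵥ u = 0
  q_v : q ⬝ᵥ v = 1
  eq_combination : ∀ x ∈ H, x = (p ⬝ᵥ x) • u + (q ⬝ᵥ x) • v
  lineForm : Submodule K (Fin 3 → K) → Fin 3 → K
  isDefiningForm_lineForm : ∀ L ∈ B.lines, IsDefiningForm L (lineForm L)
  lineForm_v : ∀ L ∈ B.lines, lineForm L ⬝ᵥ v = 1

/-! ### Degree estimates along H. -/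

namespace TransversalFrame

variable {K : Type*} [Field K] {B : LineArrangement K} {H : Submodule K (Fin 3 → K)}

theorem exists_mem_avoiding [Infinite K] (hH : Module.finrank K H = 2) (hHB : H ∉ B.lines) :
    ∃ v ∈ H, v ≠ 0 ∧ ∀ L ∈ B.lines, v ∉ L := by
  classical
  -- A space over an infinite field is not a finite union of proper subspaces; including ⊥ makes v
  -- nonzero even if B has no lines.
  let s : Finset (Subspace K H) := insert ⊥ (B.lines.image fun L => L.comap H.subtype)
  have hs : ⊤ ∉ s := by
    intro h
    rcases Finset.mem_insert.1 h with h | h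
    · have h1 := finrank_top K H
      rw [h, finrank_bot, hH] at h1
      omega
    · obtain ⟨L, hL, hLH⟩ := Finset.mem_image.1 h
      rw [Submodule.comap_subtype_eq_top] at hLH
      have := Submodule.eq_of_le_of_finrank_eq hLH (hH.trans (B.finrank_eq_two L hL).symm)
      exact hHB (this ▸ hL)
  obtain ⟨v, hv⟩ := (Set.ne_univ_iff_exists_notMem _).1 (Subspace.biUnion_ne_univ_of_top_notMem hs)
  simp only [Set.mem_iUnion, not_exists, SetLike.mem_coe] at hv
  refine ⟨v, v.2, fun h => hv ⊥ (Finset.mem_insert_self _ _) ?_, fun L hL hvL => ?_⟩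
  · rw [Submodule.mem_bot]
    exact Subtype.ext h
  · exact hv (L.comap H.subtype) (Finset.mem_insert_of_mem (Finset.mem_image_of_mem _ hL)) hvL

theorem nonempty [Infinite K] (hH : Module.finrank K H = 2) (hHB : H ∉ B.lines) :
    Nonempty (TransversalFrame B H) := by
  obtain ⟨v, hv, hv0, hvB⟩ := exists_mem_avoiding hH hHB
  obtain ⟨u, hu, p, q, hpu, hpv, hqu, hqv, hcomb⟩ := exists_adapted_frame hH hv hv0
  obtain ⟨α, hα⟩ := exists_isDefiningForm hH
  have hex : ∀ L, ∃ c : Fin 3 → K, L ∈ B.lines → IsDefiningForm L c ∧ c ⬝ᵥ v = 1 := fun L => by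
    by_cases hL : L ∈ B.lines
    · obtain ⟨c, hc⟩ := exists_isDefiningForm (B.finrank_eq_two L hL)
      have hcv : c ⬝ᵥ v ≠ 0 := fun h => hvB L hL ((hc.mem_iff v).2 h)
      refine ⟨(c ⬝ᵥ v)⁻¹ • c, fun _ => ⟨hc.smul (inv_ne_zero hcv), ?_⟩⟩
      rw [smul_dotProduct, smul_eq_mul, inv_mul_cancel₀ hcv]
    · exact ⟨0, fun h => absurd h hL⟩
  choose c hc using hex
  exact ⟨⟨α, hα, hH, hHB, u, v, hu, hv, p, q, hpu, hpv, hqu, hqv, hcomb, c,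
    fun L hL => (hc L hL).1, fun L hL => (hc L hL).2⟩⟩

variable (F : TransversalFrame B H)

/-- The coordinate on the line `u + t v` of the intersection point with `L`. -/
def coord (L : Submodule K (Fin 3 → K)) : K := -(F.lineForm L ⬝ᵥ F.u)

open scoped Classical in
/-- The coordinates of the intersection points of `H` with the lines of `B`. -/
def coords : Finset K := B.lines.image F.coord

theorem form_ne_zero : F.form ≠ 0 := F.isDefiningForm_form.ne_zero F.finrank_eq_two

theorem form_prime : Prime (linForm F.form) := linForm_prime F.form_ne_zero

theorem restrictLine_form : restrictLine F.u F.v (linForm F.form) = 0 := by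
  rw [restrictLine_linForm, (F.isDefiningForm_form.mem_iff _).1 F.u_mem,
    (F.isDefiningForm_form.mem_iff _).1 F.v_mem]
  simp

theorem restrictLine_lineForm {L : Submodule K (Fin 3 → K)} (hL : L ∈ B.lines) :
    restrictLine F.u F.v (linForm (F.lineForm L)) = Polynomial.X - Polynomial.C (F.coord L) := by
  rw [restrictLine_linForm, F.lineForm_v L hL, coord]
  simp [add_comm]

theorem exists_eq_smul_form {e : Fin 3 → K} (hu : e ⬝ᵥ F.u = 0) (hv : e ⬝ᵥ F.v = 0) :
    ∃ r : K, e = r • F.form := by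
  refine exists_eq_smul_of_ker_le F.form_ne_zero fun x hx => ?_
  rw [F.eq_combination x ((F.isDefiningForm_form.mem_iff x).2 hx), dotProduct_add,
    dotProduct_smul, dotProduct_smul, hu, hv, smul_zero, smul_zero, add_zero]

theorem form_dvd_of_restrictLine_eq_zero [Infinite K] {f : MvPolynomial (Fin 3) K} {d : ℕ}
    (hf : f.IsHomogeneous d) (h : restrictLine F.u F.v f = 0) : linForm F.form ∣ f := by
  rw [linForm_dvd_iff F.form_ne_zero]
  intro x hx
  rw [F.eq_combination x ((F.isDefiningForm_form.mem_iff x).2 hx)]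
  exact eval_eq_zero_of_restrictLine_eq_zero hf h _ _

/-- Says, without subtracting exponents, that θ(α) restricted to H vanishes to order m - 1 at a
point on m lines of B. -/
theorem prod_dvd_restrictLine_mul [Infinite K]
    {θ : Derivation K (MvPolynomial (Fin 3) K) (MvPolynomial (Fin 3) K)} (hθ : θ ∈ B.logDer) :
    ∏ L ∈ B.lines, (Polynomial.X - Polynomial.C (F.coord L)) ∣
      restrictLine F.u F.v (θ (linForm F.form)) *
        ∏ t ∈ F.coords, (Polynomial.X - Polynomial.C t) := by
  classical
  rw [← Finset.prod_fiberwise_of_maps_to (t := F.coords) (g := F.coord)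
    fun L hL => by rw [coords]; exact Finset.mem_image_of_mem _ hL]
  refine Finset.prod_dvd_of_coprime (fun t _ t' _ htt' => ?_) fun t ht => ?_
  · refine IsCoprime.prod_left fun L hL => IsCoprime.prod_right fun L' hL' => ?_
    rw [(Finset.mem_filter.1 hL).2, (Finset.mem_filter.1 hL').2]
    exact Polynomial.isCoprime_X_sub_C_of_isUnit_sub (sub_ne_zero.2 htt').isUnit
  · have ht' := ht
    rw [coords, Finset.mem_image] at ht'
    obtain ⟨L₀, hL₀, rfl⟩ := ht'
    -- Forms of lines through one point of H differ by multiples of α, so this 2 × 2 determinant is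
    -- the same for each of them and is divisible by all. On H only its first term survives.
    have hW : ∏ L ∈ B.lines with F.coord L = F.coord L₀, linForm (F.lineForm L) ∣
        linForm (F.lineForm L₀) * θ (linForm F.form)
          - linForm F.form * θ (linForm (F.lineForm L₀)) := by
      refine Finset.prod_dvd_of_isRelPrime
        ((B.isRelPrime_linForm F.isDefiningForm_lineForm).mono (Finset.filter_subset _ _))
        fun L hL => ?_
      obtain ⟨hL, hLL₀⟩ := Finset.mem_filter.1 hL
      obtain ⟨r, hr⟩ := F.exists_eq_smul_form (e := F.lineForm L₀ - F.lineForm L)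
        (by rw [sub_dotProduct]; rw [coord, coord, neg_inj] at hLL₀; rw [hLL₀, sub_self])
        (by rw [sub_dotProduct, F.lineForm_v L hL, F.lineForm_v L₀ hL₀, sub_self])
      rw [derivation_linForm_combination θ hr, linForm_combination hr]
      have e : (linForm (F.lineForm L) + C r * linForm F.form) * θ (linForm F.form)
          - linForm F.form * (θ (linForm (F.lineForm L)) + C r * θ (linForm F.form))
          = linForm (F.lineForm L) * θ (linForm F.form)
            - linForm F.form * θ (linForm (F.lineForm L)) := by ring
      rw [e]
      exact dvd_sub (dvd_mul_right _ _)
        ((hθ L hL _ (F.isDefiningForm_lineForm L hL)).mul_left _)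
    have hρ := map_dvd (restrictLine F.u F.v) hW
    rw [map_prod, map_sub, map_mul, map_mul, F.restrictLine_form, zero_mul, sub_zero,
      F.restrictLine_lineForm hL₀] at hρ
    rw [Finset.prod_congr rfl fun L hL =>
      F.restrictLine_lineForm (Finset.mem_filter.1 hL).1] at hρ
    rw [mul_comm]
    exact hρ.trans (mul_dvd_mul_right
      (Finset.dvd_prod_of_mem (fun t => Polynomial.X - Polynomial.C t) ht) _)

theorem card_le_degree_add [Infinite K]
    {θ : Derivation K (MvPolynomial (Fin 3) K) (MvPolynomial (Fin 3) K)} (hθ : θ ∈ B.logDer) {d : ℕ}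
    (hd : IsHomogeneousDerivation θ d) (h : restrictLine F.u F.v (θ (linForm F.form)) ≠ 0) :
    B.lines.card ≤ d + F.coords.card := by
  have hT : (∏ t ∈ F.coords, (Polynomial.X - Polynomial.C t)).Monic :=
    Polynomial.monic_prod_of_monic _ _ fun t _ => Polynomial.monic_X_sub_C t
  have h1 := Polynomial.natDegree_le_of_dvd (F.prod_dvd_restrictLine_mul hθ)
    (mul_ne_zero h hT.ne_zero)
  rw [Polynomial.natDegree_mul h hT.ne_zero,
    Polynomial.natDegree_prod_of_monic F.coords (fun t => Polynomial.X - Polynomial.C t)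
      fun t _ => Polynomial.monic_X_sub_C t,
    Polynomial.natDegree_prod_of_monic B.lines
      (fun L => Polynomial.X - Polynomial.C (F.coord L))
      fun L _ => Polynomial.monic_X_sub_C _] at h1
  simp only [Polynomial.natDegree_X_sub_C, Finset.sum_const, smul_eq_mul, mul_one] at h1
  exact h1.trans (Nat.add_le_add_right
    (natDegree_restrictLine_le _ _ (derivation_linForm_isHomogeneous hd F.form).totalDegree_le) _)

/-- If at least two lines of `B` pass through each intersection point on `H`, then a logarithmic
vector field of small degree that annihilates the form of `H` vanishes on `H`. -/
theorem form_dvd_derivation_X [CharZero K] (hcard : 2 ≤ F.coords.card)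
    (hfib : ∀ L ∈ B.lines, ∃ L' ∈ B.lines, L' ≠ L ∧ F.coord L' = F.coord L)
    {θ : Derivation K (MvPolynomial (Fin 3) K) (MvPolynomial (Fin 3) K)} (hθ : θ ∈ B.logDer) {d : ℕ}
    (hd : IsHomogeneousDerivation θ d) (hdn : d < F.coords.card) (h0 : θ (linForm F.form) = 0)
    (i : Fin 3) : linForm F.form ∣ θ (X i) := by
  have hdeg : ∀ e, (restrictLine F.u F.v (θ (linForm e))).degree < F.coords.card := fun e =>
    Polynomial.degree_le_natDegree.trans_lt (by
      exact_mod_cast (natDegree_restrictLine_le _ _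
        (derivation_linForm_isHomogeneous hd e).totalDegree_le).trans_lt hdn)
  have hcongr : ∀ a b : Fin 3 → K, a ⬝ᵥ F.u = b ⬝ᵥ F.u → a ⬝ᵥ F.v = b ⬝ᵥ F.v →
      θ (linForm a) = θ (linForm b) := by
    intro a b hu hv
    obtain ⟨r, hr⟩ := F.exists_eq_smul_form (e := a - b)
      (by rw [sub_dotProduct, hu, sub_self]) (by rw [sub_dotProduct, hv, sub_self])
    rw [derivation_linForm_combination θ hr, h0, mul_zero, add_zero]
  have hcomb : ∀ (a : Fin 3 → K), θ (linForm a)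
      = C (a ⬝ᵥ F.v) * θ (linForm F.q) + C (a ⬝ᵥ F.u) * θ (linForm F.p) := by
    intro a
    rw [hcongr a ((a ⬝ᵥ F.v) • F.q + (a ⬝ᵥ F.u) • F.p)
      (by simp [add_dotProduct, F.q_u, F.p_u]) (by simp [add_dotProduct, F.q_v, F.p_v])]
    simp only [derivation_linForm, Finset.mul_sum, ← Finset.sum_add_distrib]
    refine Finset.sum_congr rfl fun i _ => ?_
    simp
    ring
  -- Since θ(α) = 0, two lines through the same point have forms with the same image under θ. It is
  -- divisible by both forms, and these coincide on H.
  have htan : ∀ t ∈ F.coords, (Polynomial.X - Polynomial.C t) ^ 2 ∣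
      restrictLine F.u F.v (θ (linForm F.q))
        - Polynomial.C t * restrictLine F.u F.v (θ (linForm F.p)) := by
    classical
    intro t ht
    rw [coords, Finset.mem_image] at ht
    obtain ⟨L, hL, rfl⟩ := ht
    obtain ⟨L', hL', hne, hLL'⟩ := hfib L hL
    have h1 := hθ L hL _ (F.isDefiningForm_lineForm L hL)
    have h2 := hθ L' hL' _ (F.isDefiningForm_lineForm L' hL')
    rw [hcongr (F.lineForm L') (F.lineForm L) (by simpa [coord] using hLL')
      (by rw [F.lineForm_v L hL, F.lineForm_v L' hL'])] at h2
    have h3 := (B.isRelPrime_linForm F.isDefiningForm_lineForm hL' hL hne).mul_dvd h2 h1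
    have h4 := map_dvd (restrictLine F.u F.v) h3
    rw [map_mul, F.restrictLine_lineForm hL, F.restrictLine_lineForm hL', hLL', ← pow_two] at h4
    have h5 : restrictLine F.u F.v (θ (linForm (F.lineForm L)))
        = restrictLine F.u F.v (θ (linForm F.q))
        - Polynomial.C (F.coord L) * restrictLine F.u F.v (θ (linForm F.p)) := by
      rw [hcomb, F.lineForm_v L hL, coord, map_add, map_mul, map_mul, algHom_C, algHom_C]
      simp
    rwa [h5] at h4
  obtain ⟨hp, hq⟩ := eq_zero_of_tangent_to_second_order F.coords hcard _ _ (hdeg F.p) (hdeg F.q) htan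
  refine F.form_dvd_of_restrictLine_eq_zero (hd i) ?_
  have hX : (X i : MvPolynomial (Fin 3) K) = linForm (Pi.single i 1) := by
    simp [linForm, Pi.single_apply]
  rw [hX, hcomb, map_add, map_mul, map_mul, hp, hq, mul_zero, mul_zero, add_zero]

/-- A basis element other than the Euler derivation whose degree is less than the number of
intersection points on `H` is not tangent to `H`. -/
theorem restrictLine_basis_ne_zero [CharZero K] (hcard : 2 ≤ F.coords.card)
    (hfib : ∀ L ∈ B.lines, ∃ L' ∈ B.lines, L' ≠ L ∧ F.coord L' = F.coord L)
    (b : Module.Basis (Fin 3) (MvPolynomial (Fin 3) K) B.logDer)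
    (hb : (b 0 : Derivation K (MvPolynomial (Fin 3) K) (MvPolynomial (Fin 3) K))
      = eulerDerivation K) {i : Fin 3} (hi : i ≠ 0) {d : ℕ}
    (hd : IsHomogeneousDerivation (b i : Derivation K (MvPolynomial (Fin 3) K) _) d)
    (hdn : d < F.coords.card) :
    restrictLine F.u F.v
      ((b i : Derivation K (MvPolynomial (Fin 3) K) (MvPolynomial (Fin 3) K)) (linForm F.form)) ≠ 0 := by
  intro h0
  have hhom := derivation_linForm_isHomogeneous hd F.form
  have hdvd := F.form_dvd_of_restrictLine_eq_zero hhom h0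
  obtain ⟨h, hh, hα⟩ : ∃ h : MvPolynomial (Fin 3) K, (∀ j, (h * X j).IsHomogeneous d) ∧
      (b i : Derivation K (MvPolynomial (Fin 3) K) (MvPolynomial (Fin 3) K)) (linForm F.form)
        = linForm F.form * h := by
    -- In degree 0 divisibility by α forces the value to be zero, so h = 0 serves as the quotient.
    cases d with
    | zero =>
      refine ⟨0, fun j => by rw [zero_mul]; exact isHomogeneous_zero _ _ _, ?_⟩
      obtain ⟨g, hg⟩ := hdvd
      rw [mul_zero]
      by_contra hne
      have h1 := hhom.totalDegree hne
      rw [hg] at hne h1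
      rw [totalDegree_mul_of_isDomain (left_ne_zero_of_mul hne) (right_ne_zero_of_mul hne),
        (linForm_isHomogeneous _).totalDegree (left_ne_zero_of_mul hne)] at h1
      omega
    | succ d =>
      obtain ⟨h, hh, hα⟩ := exists_homogeneous_quotient (linForm_isHomogeneous F.form) hhom hdvd
      exact ⟨h, fun j => hh.mul (isHomogeneous_X K j), hα⟩
  set θ : B.logDer := b i - h • b 0 with hθ
  have hval : ∀ f, (θ : Derivation K (MvPolynomial (Fin 3) K) (MvPolynomial (Fin 3) K)) f
      = (b i : Derivation K (MvPolynomial (Fin 3) K) (MvPolynomial (Fin 3) K)) f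
        - h * eulerDerivation K f := by
    intro f
    simp [hθ, hb]
  have hX := F.form_dvd_derivation_X hcard hfib θ.2
    (fun j => by
      rw [hval, eulerDerivation, mkDerivation_X]
      exact (hd j).sub (hh j)) hdn
    (by rw [hval, eulerDerivation_linForm, hα]; ring)
  choose g hg using hX
  set ψ : Derivation K (MvPolynomial (Fin 3) K) (MvPolynomial (Fin 3) K) := mkDerivation K g with hψ
  have hθψ : (θ : Derivation K (MvPolynomial (Fin 3) K) (MvPolynomial (Fin 3) K))
      = linForm F.form • ψ := by
    refine derivation_ext fun j => ?_
    rw [hg j, Derivation.smul_apply, hψ, mkDerivation_X, smul_eq_mul]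
  have hψmem : ψ ∈ B.logDer := by
    intro L hL a ha
    have h1 := θ.2 L hL a ha
    rw [hθψ, Derivation.smul_apply, smul_eq_mul] at h1
    have hL2 := B.finrank_eq_two L hL
    refine ((linForm_prime (ha.ne_zero hL2)).dvd_or_dvd h1).resolve_left fun h2 => ?_
    rw [ha.linForm_dvd_linForm_iff hL2 F.finrank_eq_two F.isDefiningForm_form] at h2
    exact F.notMem (h2 ▸ hL)
  have heq : b i = linForm F.form • (⟨ψ, hψmem⟩ : B.logDer) + h • b 0 := by
    have h1 : θ = linForm F.form • (⟨ψ, hψmem⟩ : B.logDer) := Subtype.ext hθψ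
    rw [← h1, hθ]
    abel
  -- Since i ≠ 0, the i-th coordinate reads 1 = α · (coordinate of ψ), which would make α a unit.
  have h1 := congrArg (fun η => b.repr η i) heq
  simp only [map_add, map_smul, Finsupp.add_apply, Finsupp.smul_apply, b.repr_self, smul_eq_mul,
    Finsupp.single_eq_same, Finsupp.single_eq_of_ne hi, mul_zero, add_zero] at h1
  exact F.form_prime.not_isUnit (IsUnit.of_mul_eq_one _ h1.symm)

/-- Otherwise every logarithmic field would be tangent to H. But Q∂_w, with Q the product of the
normalized forms and w outside H, takes the value w at v. -/
theorem exists_basis_not_tangent [Infinite K]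
    (b : Module.Basis (Fin 3) (MvPolynomial (Fin 3) K) B.logDer) :
    ∃ i, ¬ linForm F.form ∣
      (b i : Derivation K (MvPolynomial (Fin 3) K) (MvPolynomial (Fin 3) K)) (linForm F.form) := by
  by_contra! hcon
  obtain ⟨w, hw⟩ := exists_dotProduct_eq_one F.form_ne_zero
  let θ : B.logDer := ⟨_, directionalDerivation_prod_mem F.isDefiningForm_lineForm w⟩
  have hv : derivationValue (θ : Derivation K (MvPolynomial (Fin 3) K) _) F.v = w := by
    rw [derivationValue_directional, map_prod, Finset.prod_eq_one, one_smul]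
    intro L hL
    rw [eval_linForm, F.lineForm_v L hL]
  have hmem : derivationValue (θ : Derivation K (MvPolynomial (Fin 3) K) _) F.v ∈ H := by
    rw [← b.sum_repr θ]
    rw [Submodule.coe_sum, derivationValue_sum]
    refine H.sum_mem fun i _ => ?_
    rw [Submodule.coe_smul, derivationValue_smul]
    exact H.smul_mem _ ((linForm_dvd_derivation_iff F.finrank_eq_two F.isDefiningForm_form _).1
      (hcon i) _ F.v_mem)
  rw [hv, F.isDefiningForm_form.mem_iff, hw] at hmem
  exact one_ne_zero hmem

theorem two_mul_card_coords_le
    (hfib : ∀ L ∈ B.lines, ∃ L' ∈ B.lines, L' ≠ L ∧ F.coord L' = F.coord L) :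
    2 * F.coords.card ≤ B.lines.card := by
  classical
  rw [Finset.card_eq_sum_card_fiberwise (f := F.coord) (t := F.coords)
    fun L hL => by rw [coords]; exact Finset.mem_coe.2 (Finset.mem_image_of_mem _ hL), mul_comm,
    ← smul_eq_mul]
  refine Finset.card_nsmul_le_sum _ _ _ fun t ht => ?_
  rw [coords, Finset.mem_image] at ht
  obtain ⟨L, hL, rfl⟩ := ht
  obtain ⟨L', hL', hne, hLL'⟩ := hfib L hL
  exact Finset.one_lt_card.2 ⟨L', Finset.mem_filter.2 ⟨hL', hLL'⟩, L,
    Finset.mem_filter.2 ⟨hL, rfl⟩, hne⟩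

/-- A free arrangement has a line meeting `H` in a point that lies on no other line. -/
theorem not_isFree [CharZero K] (hcard : 2 ≤ F.coords.card)
    (hfib : ∀ L ∈ B.lines, ∃ L' ∈ B.lines, L' ≠ L ∧ F.coord L' = F.coord L) : ¬ B.IsFree := by
  rintro ⟨d₂, d₃, b, hb, h₂, h₃⟩
  have hm := F.two_mul_card_coords_le hfib
  have hne : B.lines.Nonempty := Finset.card_pos.1 (by omega)
  have hd : ∀ i, IsHomogeneousDerivation (b i : Derivation K (MvPolynomial (Fin 3) K) _)
      (![1, d₂, d₃] i) := by
    intro i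
    fin_cases i
    · intro j
      change ((b 0 : Derivation K (MvPolynomial (Fin 3) K) (MvPolynomial (Fin 3) K)) (X j)).IsHomogeneous 1
      rw [hb, eulerDerivation, mkDerivation_X]
      exact isHomogeneous_X K j
    · exact h₂
    · exact h₃
  have hsum := sum_degrees_le_card hne b hd
  simp only [Fin.sum_univ_three, Matrix.cons_val_zero, Matrix.cons_val_one, Matrix.cons_val] at hsum
  have hsmall₂ := F.restrictLine_basis_ne_zero hcard hfib b hb (by decide) h₂
  have hsmall₃ := F.restrictLine_basis_ne_zero hcard hfib b hb (by decide) h₃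
  have hlarge₂ := F.card_le_degree_add (b 1).2 h₂
  have hlarge₃ := F.card_le_degree_add (b 2).2 h₃
  by_cases z₂ : restrictLine F.u F.v ((b 1 : Derivation K (MvPolynomial (Fin 3) K) (MvPolynomial (Fin 3) K)) (linForm F.form)) = 0
  · by_cases z₃ : restrictLine F.u F.v ((b 2 : Derivation K (MvPolynomial (Fin 3) K) (MvPolynomial (Fin 3) K)) (linForm F.form)) = 0
    · obtain ⟨i, hi⟩ := F.exists_basis_not_tangent b
      apply hi
      fin_cases i
      · change linForm F.form ∣ (b 0 : Derivation K (MvPolynomial (Fin 3) K) (MvPolynomial (Fin 3) K)) (linForm F.form)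
        rw [hb, eulerDerivation_linForm]
      · exact F.form_dvd_of_restrictLine_eq_zero (derivation_linForm_isHomogeneous h₂ _) z₂
      · exact F.form_dvd_of_restrictLine_eq_zero (derivation_linForm_isHomogeneous h₃ _) z₃
    · have h1 := hlarge₃ z₃
      exact hsmall₂ (by omega) z₂
  · have h1 := hlarge₂ z₂
    by_cases z₃ : restrictLine F.u F.v ((b 2 : Derivation K (MvPolynomial (Fin 3) K) (MvPolynomial (Fin 3) K)) (linForm F.form)) = 0
    · exact hsmall₃ (by omega) z₃
    · have h2 := hlarge₃ z₃
      omega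

/-! ### Intersection points on H in coordinates. -/

theorem mem_line_iff {L : Submodule K (Fin 3 → K)} (hL : L ∈ B.lines) {x : Fin 3 → K}
    (hx : x ∈ H) : x ∈ L ↔ F.q ⬝ᵥ x = F.coord L * (F.p ⬝ᵥ x) := by
  rw [(F.isDefiningForm_lineForm L hL).mem_iff]
  nth_rewrite 1 [F.eq_combination x hx]
  rw [dotProduct_add, dotProduct_smul, dotProduct_smul, F.lineForm_v L hL, coord]
  simp only [smul_eq_mul]
  constructor
  · intro h; linear_combination h
  · intro h; linear_combination h

theorem add_smul_mem (t : K) : F.u + t • F.v ∈ H :=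
  H.add_mem F.u_mem (H.smul_mem t F.v_mem)

theorem p_add_smul (t : K) : F.p ⬝ᵥ (F.u + t • F.v) = 1 := by
  simp [dotProduct_add, F.p_u, F.p_v]

theorem q_add_smul (t : K) : F.q ⬝ᵥ (F.u + t • F.v) = t := by
  simp [dotProduct_add, F.q_u, F.q_v]

theorem add_smul_mem_line_iff {L : Submodule K (Fin 3 → K)} (hL : L ∈ B.lines) (t : K) :
    F.u + t • F.v ∈ L ↔ F.coord L = t := by
  rw [F.mem_line_iff hL (F.add_smul_mem t), p_add_smul, q_add_smul, mul_one, eq_comm]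

theorem add_smul_ne_zero (t : K) : F.u + t • F.v ≠ 0 := by
  intro h
  have := F.p_add_smul t
  simp [h] at this

theorem inf_eq_span {L : Submodule K (Fin 3 → K)} (hL : L ∈ B.lines) :
    H ⊓ L = Submodule.span K {F.u + F.coord L • F.v} := by
  apply le_antisymm
  · rintro x ⟨hxH, hxL⟩
    refine Submodule.mem_span_singleton.2 ⟨F.p ⬝ᵥ x, ?_⟩
    nth_rewrite 2 [F.eq_combination x hxH]
    rw [(F.mem_line_iff hL hxH).1 hxL, smul_add, smul_smul, mul_comm]
  · rw [Submodule.span_singleton_le_iff_mem]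
    exact ⟨F.add_smul_mem _, (F.add_smul_mem_line_iff hL _).2 rfl⟩

end TransversalFrame

/-! ### The main theorem. -/

theorem theorem1p7 {K : Type*} [Field K] [CharZero K]
    (A : LineArrangement K) (hA : A.IsEssential)
    (H : Submodule K (Fin 3 → K)) (hH : H ∈ A.lines)
    (hfree : (A.erase H).IsFree) :
    A.n2On H ≤ A.n2 ∧ 0 < A.n2On H := by
  classical
  refine ⟨Set.ncard_le_ncard (fun p hp => hp.1) A.finite_doublePoints, ?_⟩
  have hlines : ∀ L, L ∈ (A.erase H).lines ↔ L ≠ H ∧ L ∈ A.lines := fun L => by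
    simp [LineArrangement.erase]
  obtain ⟨F⟩ := TransversalFrame.nonempty (B := A.erase H) (A.finrank_eq_two H hH)
    (fun h => ((hlines H).1 h).1 rfl)
  by_contra hpos
  have hfin : {p | p ∈ A.doublePoints ∧ p ≤ H}.Finite :=
    A.finite_doublePoints.subset fun p hp => hp.1
  have hempty : {p | p ∈ A.doublePoints ∧ p ≤ H} = ∅ :=
    (Set.ncard_eq_zero hfin).1 (Nat.eq_zero_of_not_pos hpos)
  refine F.not_isFree ?_ ?_ hfree
  -- With at most one coordinate t, the nonzero vector u + t v would lie on every line of the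
  -- arrangement, against essentiality.
  · by_contra hcard
    obtain ⟨t, ht⟩ : ∃ t, ∀ L ∈ (A.erase H).lines, F.coord L = t := by
      have h1 : F.coords.card ≤ 1 := by omega
      obtain ⟨t, ht⟩ := Finset.card_le_one_iff_subset_singleton.1 h1
      refine ⟨t, fun L hL => Finset.mem_singleton.1 (ht ?_)⟩
      rw [TransversalFrame.coords]
      exact Finset.mem_image_of_mem _ hL
    obtain ⟨S, hS, hbot⟩ := hA
    apply F.add_smul_ne_zero t
    rw [← Submodule.mem_bot K, hbot, Submodule.mem_finsetInf]
    intro L hL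
    by_cases hLH : L = H
    · rw [hLH]
      exact F.add_smul_mem t
    · have hL' := (hlines L).2 ⟨hLH, hS hL⟩
      exact (F.add_smul_mem_line_iff hL' t).2 (ht L hL')
  · intro L hL
    -- If no other line of the smaller arrangement meets H where L does, then H ⊓ L is a double
    -- point on H.
    by_contra! hcon
    obtain ⟨hLH, hLA⟩ := (hlines L).1 hL
    have hspan := F.inf_eq_span hL
    suffices hmem : H ⊓ L ∈ {p | p ∈ A.doublePoints ∧ p ≤ H} by
      rw [hempty] at hmem
      exact hmem
    refine ⟨⟨⟨⟨{H, L}, ?_, ?_⟩, ?_⟩, ?_⟩, inf_le_left⟩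
    · intro M hM
      rcases Finset.mem_insert.1 hM with rfl | hM
      · exact hH
      · rwa [Finset.mem_singleton.1 hM]
    · simp
    · rw [hspan]
      exact finrank_span_singleton (F.add_smul_ne_zero _)
    · have hfilter : A.lines.filter (fun M => H ⊓ L ≤ M) = {H, L} := by
        ext M
        rw [Finset.mem_filter, Finset.mem_insert, Finset.mem_singleton]
        constructor
        · rintro ⟨hM, hle⟩
          by_cases hMH : M = H
          · exact Or.inl hMH
          · right
            by_contra hML
            have hM' := (hlines M).2 ⟨hMH, hM⟩
            rw [hspan, Submodule.span_singleton_le_iff_mem, F.add_smul_mem_line_iff hM'] at hle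
            exact hcon M hM' hML hle
        · rintro (rfl | rfl)
          exacts [⟨hH, inf_le_left⟩, ⟨hLA, inf_le_right⟩]
      rw [LineArrangement.mu]
      have hc : (A.lines.filter (fun M => H ⊓ L ≤ M)).card = 2 := by
        rw [hfilter, Finset.card_pair (Ne.symm hLH)]
      rw [hc]
      norm_num

end
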